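/- Let $p>3$ be a prime and let $m$ be a positive integer not divisible by $p$. For rational numbers $x,y$ and an integer $e\ge 1$, write $x\equiv y\pmod{p^e}$ if $x-y=p^e z$ for some rational number $z$ whose reduced denominator is not divisible by $p$. Let $\binom{a}{k}=\frac{a(a-1)\cdots(a-k+1)}{k!}$ for $a\in\mathbb{Q}$ and integers $k\ge 0$, and let $B_0,B_1,B_2,\ldots$ be the Bernoulli numbers. (i) If $p>5$, then $$\sum_{k=1}^{p-1}\frac{(-1)^{km}}{k^2}\binom{p/m-1}{k}^m\equiv\frac1p\sum_{k=1}^{p-1}\frac1k\pmod{p^3}.$$ Also (without the restriction $p>5$), for any $n=1,\ldots,(p-3)/2$ we have $$\sum_{k=1}^{p-1}\frac{(-1)^{km}}{k^{2n}}\binom{p/m-1}{k}^m\equiv-\frac{p}{2n+1}B_{p-1-2n}\pmod{p^2}.$$ (ii) For every $n=1,\ldots,(p-3)/2$ we have $$\sum_{k=1}^{p-1}\frac{(-1)^{km}}{k^{2n-1}}\binom{p/m-1}{k}^m\equiv\left(1+\frac{1-m}{2m}(2n+1)\right)\frac{p^2n}{2n+1}B_{p-1-2n}\pmod{p^3}.$$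 -/

import Mathlib

/-- Congruence modulo the prime power `p ^ e` between rational numbers (in the ring of `p`-integral
rationals): `x - y` is `p ^ e` times a rational number whose reduced denominator is not divisible
by `p`. -/
def RatModEq (p e : ℕ) (x y : ℚ) : Prop :=
  ∃ z : ℚ, ¬ p ∣ z.den ∧ x - y = (p : ℚ) ^ e * z

/-- The sum `∑_{k=1}^{p-1} (-1)^{km} / k^s * binom(p/m - 1, k)^m`, where the binomial coefficient
is the generalized one, `binom(a, k) = a (a - 1) ⋯ (a - k + 1) / k!` for rational `a`. -/
noncomputable def binomPowSum (p m s : ℕ) : ℚ :=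
  ∑ k ∈ Finset.Icc 1 (p - 1),
    (-1 : ℚ) ^ (k * m) / (k : ℚ) ^ s * (Ring.choose ((p : ℚ) / (m : ℚ) - 1) k) ^ m

/-! Let H_s(k) be the sum of j^{-s} over j ≤ k, H_s = H_s(p-1), and h_s the complete homogeneous
polynomial of degree s in 1, 1/2, …, 1/(p-1). Since (-1)^k C(p/m-1, k) = ∏_{j≤k} (1 - p/(mj)), its
m-th power agrees modulo p^3 with the value for m = 1 plus (m-1)/(2m) p² H_2(k)
(`pdvd_prod_pow_sub`). For m = 1 the sum is exactly -h_s, by a binomial identity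
(`sum_prod_mul_inv_pow`). So the sum is -h_s + (m-1)/(2m) p² Σ H_2(k)/k^s modulo p^3
(`pdvd_binomPowSum_add`).

Newton's identities express h_s through power sums, which are divisible by p, and by p² for odd
index; the reflection k ↦ p - k relates H_s to p H_{s+1} for odd s. The double sums Σ H_d(k)/k^s are
needed only modulo p, where Fermat and Faulhaber turn them into one Bernoulli number
(`pdvd_mul_sum_invPowSum_mul`). -/

/-- `PDvd p e x` says that `x` lies in `p ^ e ℤ_(p)`, the rationals whose `p`-adic valuation is at
least `e`. -/
def PDvd (p e : ℕ) (x : ℚ) : Prop :=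
  ∃ a b : ℤ, ¬ (p : ℤ) ∣ b ∧ x * b = (p : ℚ) ^ e * a

/-! ### Arithmetic of the ideals p^e ℤ_(p) -/

namespace PDvd

variable {p d e : ℕ} {x y : ℚ}

theorem ratModEq (h : PDvd p e (x - y)) : RatModEq p e x y := by
  obtain ⟨a, b, hb, h⟩ := h
  have hb0 : (b : ℚ) ≠ 0 := by
    rintro h0
    exact hb (by rw [Int.cast_eq_zero.mp h0]; exact dvd_zero _)
  refine ⟨a / b, fun hd => hb ?_, ?_⟩
  · have := Rat.den_dvd a b
    rw [Rat.divInt_eq_div] at this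
    exact (Int.natCast_dvd_natCast.mpr hd).trans this
  · field_simp
    linarith

theorem neg (hx : PDvd p e x) : PDvd p e (-x) := by
  obtain ⟨a, b, hb, h⟩ := hx
  exact ⟨-a, b, hb, by push_cast; linear_combination -h⟩

theorem mono (hx : PDvd p e x) (h : d ≤ e) : PDvd p d x := by
  obtain ⟨a, b, hb, hx⟩ := hx
  obtain ⟨c, rfl⟩ := Nat.exists_eq_add_of_le h
  exact ⟨p ^ c * a, b, hb, by rw [hx, pow_add]; push_cast; ring⟩

theorem inv_int {a : ℤ} (ha : ¬ (p : ℤ) ∣ a) : PDvd p 0 ((a : ℚ)⁻¹) := by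
  have h0 : (a : ℚ) ≠ 0 := by
    rintro h0
    exact ha (by rw [Int.cast_eq_zero.mp h0]; exact dvd_zero _)
  exact ⟨1, a, ha, by simp [h0]⟩

theorem inv_nat {a : ℕ} (ha : ¬ p ∣ a) : PDvd p 0 ((a : ℚ)⁻¹) := by
  have := inv_int (p := p) (a := a) (by exact_mod_cast ha)
  simpa using this

theorem inv_nat_of_lt {a : ℕ} (h0 : 0 < a) (h : a < p) : PDvd p 0 ((a : ℚ)⁻¹) :=
  inv_nat (Nat.not_dvd_of_pos_of_lt h0 h)

variable [hp : Fact p.Prime]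

theorem int (a : ℤ) : PDvd p 0 (a : ℚ) :=
  ⟨a, 1, fun h => hp.out.one_lt.ne' (by exact_mod_cast Int.eq_one_of_dvd_one (by positivity) h),
    by simp⟩

theorem nat (a : ℕ) : PDvd p 0 (a : ℚ) := by exact_mod_cast int (p := p) (a : ℤ)

theorem one : PDvd p 0 (1 : ℚ) := by exact_mod_cast nat (p := p) 1

theorem self : PDvd p 1 (p : ℚ) := by
  obtain ⟨a, b, hb, h⟩ := one (p := p)
  exact ⟨a, b, hb, by rw [pow_zero, one_mul, one_mul] at h; rw [h, pow_one]⟩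

theorem mul (hx : PDvd p d x) (hy : PDvd p e y) : PDvd p (d + e) (x * y) := by
  obtain ⟨a, b, hb, h⟩ := hx
  obtain ⟨a', b', hb', h'⟩ := hy
  refine ⟨a * a', b * b', fun hd => ?_, ?_⟩
  · exact ((Nat.prime_iff_prime_int.mp hp.out).dvd_or_dvd hd).elim hb hb'
  · push_cast
    rw [pow_add]
    linear_combination x * b * h' + p ^ e * a' * h

theorem add (hx : PDvd p e x) (hy : PDvd p e y) : PDvd p e (x + y) := by
  obtain ⟨a, b, hb, h⟩ := hx
  obtain ⟨a', b', hb', h'⟩ := hy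
  refine ⟨a * b' + a' * b, b * b', fun hd => ?_, ?_⟩
  · exact ((Nat.prime_iff_prime_int.mp hp.out).dvd_or_dvd hd).elim hb hb'
  · push_cast
    linear_combination b' * h + b * h'

theorem sub (hx : PDvd p e x) (hy : PDvd p e y) : PDvd p e (x - y) :=
  sub_eq_add_neg x y ▸ hx.add hy.neg

theorem zero : PDvd p e (0 : ℚ) :=
  ⟨0, 1, fun h => hp.out.one_lt.ne' (by exact_mod_cast Int.eq_one_of_dvd_one (by positivity) h),
    by simp⟩

theorem mul_left (hx : PDvd p 0 x) (hy : PDvd p e y) : PDvd p e (x * y) :=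
  (hx.mul hy).mono (by lia)

theorem mul_right (hx : PDvd p e x) (hy : PDvd p 0 y) : PDvd p e (x * y) :=
  (hx.mul hy).mono (by lia)

theorem pow (hx : PDvd p e x) (n : ℕ) : PDvd p (e * n) (x ^ n) := by
  induction n with
  | zero => simpa using one
  | succ n ih => rw [pow_succ, Nat.mul_succ]; exact ih.mul hx

theorem sum {ι : Type*} {s : Finset ι} {f : ι → ℚ} (h : ∀ i ∈ s, PDvd p e (f i)) :
    PDvd p e (∑ i ∈ s, f i) := by
  classical
  induction s using Finset.induction_on with
  | empty => simpa using zero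
  | insert i s hi ih =>
    rw [Finset.sum_insert hi]
    exact (h i (by simp)).add (ih fun j hj => h j (by simp [hj]))

theorem of_nat_mul {a : ℕ} (h0 : 0 < a) (h : a < p) (hx : PDvd p e (a * x)) : PDvd p e x := by
  have := (inv_nat_of_lt h0 h).mul_left hx
  rwa [inv_mul_cancel_left₀ (by positivity)] at this

theorem of_p_mul (hx : PDvd p (e + 1) (p * x)) : PDvd p e x := by
  obtain ⟨a, b, hb, h⟩ := hx
  have h0 : (p : ℚ) ≠ 0 := by exact_mod_cast hp.out.ne_zero
  exact ⟨a, b, hb, mul_left_cancel₀ h0 (by rw [← mul_assoc, h, pow_succ]; ring)⟩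

theorem of_zmod {a : ℤ} (h : (a : ZMod p) = 0) : PDvd p 1 (a : ℚ) := by
  obtain ⟨c, rfl⟩ := (ZMod.intCast_zmod_eq_zero_iff_dvd _ _).mp h
  push_cast
  exact self.mul_right (int c)

end PDvd

/-! ### Power sums, complete homogeneous sums and an alternating binomial identity -/

/-- The power sum `∑_{k=1}^N k^{-s}`. -/
def invPowSum (s N : ℕ) : ℚ := ∑ k ∈ Finset.Icc 1 N, (k : ℚ)⁻¹ ^ s

/-- The complete homogeneous symmetric polynomial of degree `s` in `1, 1/2, …, 1/N`. -/
def invHsymm : ℕ → ℕ → ℚ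
  | 0, _ => 1
  | _ + 1, 0 => 0
  | s + 1, N + 1 => invHsymm (s + 1) N + ((N + 1 : ℕ) : ℚ)⁻¹ * invHsymm s (N + 1)

theorem invHsymm_zero (N : ℕ) : invHsymm 0 N = 1 := by rw [invHsymm]

theorem invHsymm_succ_zero (s : ℕ) : invHsymm (s + 1) 0 = 0 := by rw [invHsymm]

theorem invHsymm_succ_succ (s N : ℕ) :
    invHsymm (s + 1) (N + 1) =
      invHsymm (s + 1) N + ((N + 1 : ℕ) : ℚ)⁻¹ * invHsymm s (N + 1) := by rw [invHsymm]

theorem invPowSum_succ (s N : ℕ) :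
    invPowSum s (N + 1) = invPowSum s N + ((N + 1 : ℕ) : ℚ)⁻¹ ^ s := by
  rw [invPowSum, Finset.sum_Icc_succ_top (by lia), invPowSum]

theorem invHsymm_succ_right (s N : ℕ) :
    invHsymm s (N + 1) =
      ∑ i ∈ Finset.range (s + 1), ((N + 1 : ℕ) : ℚ)⁻¹ ^ i * invHsymm (s - i) N := by
  induction s with
  | zero => simp [invHsymm_zero]
  | succ s ih =>
    rw [invHsymm_succ_succ, ih, Finset.sum_range_succ' _ (s + 1), Finset.mul_sum, add_comm]
    simp [pow_succ', mul_assoc]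

/-- Newton's identity between complete homogeneous polynomials and power sums. -/
theorem succ_mul_invHsymm (s N : ℕ) :
    ((s : ℚ) + 1) * invHsymm (s + 1) N =
      ∑ i ∈ Finset.range (s + 1), invPowSum (i + 1) N * invHsymm (s - i) N := by
  induction N generalizing s with
  | zero => simp [invHsymm_succ_zero, invPowSum]
  | succ N ihN =>
    induction s with
    | zero =>
      have := ihN 0
      simp only [Nat.cast_zero, zero_add, one_mul, Finset.sum_range_one, invHsymm_zero,
        mul_one, Nat.sub_zero] at this ⊢
      rw [invHsymm_succ_succ, invPowSum_succ, this, invHsymm_zero]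
      ring
    | succ s ihs =>
      have hN := ihN (s + 1)
      have hx := invHsymm_succ_right (s + 1) N
      rw [Finset.sum_range_succ, Nat.sub_self, invHsymm_zero] at hN hx ⊢
      -- Peeling 1/(N+1) off both factors leaves Newton's identity for N, the expansion of
      -- `invHsymm` in powers of 1/(N+1), and Newton's identity one degree lower.
      have hsum : ∑ i ∈ Finset.range (s + 1), invPowSum (i + 1) (N + 1) *
            invHsymm (s + 1 - i) (N + 1) =
          ∑ i ∈ Finset.range (s + 1), invPowSum (i + 1) N * invHsymm (s + 1 - i) N +
          ((N + 1 : ℕ) : ℚ)⁻¹ * ∑ i ∈ Finset.range (s + 1),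
            ((N + 1 : ℕ) : ℚ)⁻¹ ^ i * invHsymm (s + 1 - i) N +
          ((N + 1 : ℕ) : ℚ)⁻¹ * ∑ i ∈ Finset.range (s + 1),
            invPowSum (i + 1) (N + 1) * invHsymm (s - i) (N + 1) := by
        rw [Finset.mul_sum, Finset.mul_sum, ← Finset.sum_add_distrib, ← Finset.sum_add_distrib]
        refine Finset.sum_congr rfl fun i hi => ?_
        have hi' : s + 1 - i = (s - i) + 1 := by
          have := Finset.mem_range.mp hi
          lia
        rw [hi', invHsymm_succ_succ, invPowSum_succ]
        ring
      rw [hsum, ← ihs, invHsymm_succ_succ, invPowSum_succ (s + 1 + 1)]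
      push_cast at hN hx ⊢
      linear_combination hN + (N + 1 : ℚ)⁻¹ * hx

/-- Pascal's rule and C(n-1, k-1)/k = C(n, k)/n give the left side the recursion that defines
`invHsymm`. For s = 0 it is the vanishing alternating binomial sum without its k = 0 term. -/
theorem sum_neg_one_pow_choose_mul_inv_pow (s N : ℕ) :
    ∑ k ∈ Finset.Icc 1 (N + 1), (-1 : ℚ) ^ k * ((N + 1).choose k) * (k : ℚ)⁻¹ ^ s =
      -invHsymm s (N + 1) := by
  induction s generalizing N with
  | zero =>
    have h := Int.alternating_sum_range_choose_of_ne (n := N + 1) (by lia)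
    rw [Finset.range_eq_Ico, Finset.sum_eq_sum_Ico_succ_bot (by lia)] at h
    have h' : Finset.Icc 1 (N + 1) = Finset.Ico (0 + 1) (N + 1 + 1) := by ext; simp
    rw [invHsymm_zero, h']
    have h2 := congrArg (Int.cast : ℤ → ℚ) h
    push_cast at h2
    simp only [pow_zero, Nat.choose_zero_right, Nat.cast_one, mul_one] at h2 ⊢
    linear_combination h2
  | succ s ih =>
    induction N with
    | zero =>
      simp [invHsymm_succ_succ, invHsymm_succ_zero, ← ih]
    | succ N ihN =>
      have key : ∀ k ∈ Finset.Icc 1 (N + 1 + 1),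
          (-1 : ℚ) ^ k * ((N + 1 + 1).choose k) * (k : ℚ)⁻¹ ^ (s + 1) =
          (-1 : ℚ) ^ k * ((N + 1).choose k) * (k : ℚ)⁻¹ ^ (s + 1) +
          ((N + 1 + 1 : ℕ) : ℚ)⁻¹ * ((-1 : ℚ) ^ k * ((N + 1 + 1).choose k) * (k : ℚ)⁻¹ ^ s) := by
        intro k hk
        obtain ⟨j, rfl⟩ : ∃ j, k = j + 1 := ⟨k - 1, by simp at hk; lia⟩
        have h1 : ((N + 1 + 1).choose (j + 1) : ℚ) =
            (N + 1).choose j + (N + 1).choose (j + 1) := by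
          exact_mod_cast Nat.choose_succ_succ (N + 1) j
        have h2 : ((N + 1 + 1 : ℕ) : ℚ) * (N + 1).choose j =
            (N + 1 + 1).choose (j + 1) * ((j + 1 : ℕ) : ℚ) := by
          exact_mod_cast Nat.add_one_mul_choose_eq (N + 1) j
        have h3 : ((N + 1 + 1 : ℕ) : ℚ) ≠ 0 := by positivity
        have h4 : ((j + 1 : ℕ) : ℚ) ≠ 0 := by positivity
        have h5 : ((N + 1).choose j : ℚ) * ((j + 1 : ℕ) : ℚ)⁻¹ =
            ((N + 1 + 1 : ℕ) : ℚ)⁻¹ * (N + 1 + 1).choose (j + 1) := by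
          field_simp
          linear_combination h2
        rw [pow_succ _ s]
        linear_combination (-1 : ℚ) ^ (j + 1) * ((j + 1 : ℕ) : ℚ)⁻¹ ^ s *
          ((j + 1 : ℕ) : ℚ)⁻¹ * h1 + (-1 : ℚ) ^ (j + 1) * ((j + 1 : ℕ) : ℚ)⁻¹ ^ s * h5
      rw [Finset.sum_congr rfl key, Finset.sum_add_distrib, ← Finset.mul_sum, ih,
        Finset.sum_Icc_succ_top (by lia), ihN, Nat.choose_succ_self, invHsymm_succ_succ s (N + 1)]
      simp
      ring

/-! ### Divisibility of H_s and h_s by powers of p -/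

section PowerSums

variable {p : ℕ}

theorem PDvd.one_sub_ne_zero {y : ℚ} (hy : PDvd p 1 y) : 1 - y ≠ 0 := by
  obtain ⟨a, b, hb, h⟩ := hy
  intro h0
  have : y = 1 := by linarith
  rw [this, pow_one, one_mul] at h
  exact hb ⟨a, by exact_mod_cast h⟩

theorem sum_Icc_reflect (f : ℕ → ℚ) :
    ∑ k ∈ Finset.Icc 1 (p - 1), f (p - k) = ∑ k ∈ Finset.Icc 1 (p - 1), f k :=
  Finset.sum_bij' (fun k _ => p - k) (fun k _ => p - k)
    (fun k hk => by simp at hk ⊢; lia) (fun k hk => by simp at hk ⊢; lia)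
    (fun k hk => by simp at hk ⊢; lia) (fun k hk => by simp at hk ⊢; lia) (fun _ _ => rfl)

theorem inv_cast_sub {k : ℕ} (h0 : 0 < k) (hk : k < p) :
    ((p - k : ℕ) : ℚ)⁻¹ = -((k : ℚ)⁻¹ * (1 - p * (k : ℚ)⁻¹)⁻¹) := by
  have hk0 : (k : ℚ) ≠ 0 := by positivity
  rw [Nat.cast_sub hk.le, ← mul_inv, ← inv_neg]
  congr 1
  field_simp
  ring

theorem PDvd.inv_one_sub {y : ℚ} (hy : PDvd p 1 y) : PDvd p 0 (1 - y)⁻¹ := by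
  have h0 := hy.one_sub_ne_zero
  obtain ⟨a, b, hb, h⟩ := hy
  refine ⟨b, b - p * a, fun hd => hb ?_, ?_⟩
  · simpa using dvd_add hd (dvd_mul_right (p : ℤ) a)
  · field_simp
    push_cast
    linear_combination h

variable [hp : Fact p.Prime]

open Finset in
theorem pdvd_sum_pow_add_ite (l : ℕ) :
    PDvd p 1 (∑ k ∈ Icc 1 (p - 1), (k : ℚ) ^ l + if p - 1 ∣ l then 1 else 0) := by
  have hbij : ∑ k ∈ Icc 1 (p - 1), (k : ZMod p) ^ l = ∑ u : (ZMod p)ˣ, (u : ZMod p) ^ l :=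
    Finset.sum_bij'
      (fun v hv ↦ Units.mk0 (v : ZMod p) (mt (ZMod.natCast_eq_zero_iff v p).mp (by
        have hv' := Finset.mem_Icc.mp hv
        exact Nat.not_dvd_of_pos_of_lt (by lia) (by lia))))
      (fun u _ ↦ (u : ZMod p).val)
      (fun _ _ ↦ Finset.mem_univ _)
      (fun u _ ↦ by grind [u.ne_zero, ZMod.val_ne_zero, ZMod.val_lt])
      (fun v hv ↦ by
        have hv' := Finset.mem_Icc.mp hv
        simp [ZMod.val_cast_of_lt (show v < p by lia)])
      (fun u _ ↦ Units.ext (ZMod.natCast_zmod_val _))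
      (fun _ _ ↦ rfl)
  have h := PDvd.of_zmod (p := p)
    (a := ∑ k ∈ Icc 1 (p - 1), (k : ℤ) ^ l + if p - 1 ∣ l then 1 else 0) (by
      push_cast
      rw [hbij, FiniteField.sum_pow_units, ZMod.card]
      grind)
  push_cast at h
  exact h

theorem pdvd_pow_card_sub_one_sub_one {k : ℕ} (h0 : 0 < k) (hk : k < p) :
    PDvd p 1 ((k : ℚ) ^ (p - 1) - 1) := by
  have h := PDvd.of_zmod (p := p) (a := (k : ℤ) ^ (p - 1) - 1) (by
    push_cast
    rw [ZMod.pow_card_sub_one_eq_one, sub_self]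
    exact mt (ZMod.natCast_eq_zero_iff k p).mp (Nat.not_dvd_of_pos_of_lt h0 hk))
  push_cast at h
  exact h

theorem pdvd_inv_pow_sub_pow {k d : ℕ} (h0 : 0 < k) (hk : k < p) (hd : d ≤ p - 1) :
    PDvd p 1 ((k : ℚ)⁻¹ ^ d - (k : ℚ) ^ (p - 1 - d)) := by
  have hk0 : (k : ℚ) ≠ 0 := by positivity
  have h := ((PDvd.inv_nat_of_lt h0 hk).pow d).mul
    (pdvd_pow_card_sub_one_sub_one h0 hk).neg
  convert h.mono (show 1 ≤ _ by lia) using 1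
  have : (k : ℚ) ^ (p - 1) = k ^ (p - 1 - d) * k ^ d := by
    rw [← pow_add, Nat.sub_add_cancel hd]
  rw [this, inv_pow]
  field_simp
  ring

theorem pdvd_invPowSum {s : ℕ} (h1 : 1 ≤ s) (hs : s + 2 ≤ p) :
    PDvd p 1 (invPowSum s (p - 1)) := by
  have h := pdvd_sum_pow_add_ite (p := p) (p - 1 - s)
  rw [if_neg (Nat.not_dvd_of_pos_of_lt (by lia) (by lia)), add_zero] at h
  have h' : PDvd p 1 (∑ k ∈ Finset.Icc 1 (p - 1), ((k : ℚ)⁻¹ ^ s - (k : ℚ) ^ (p - 1 - s))) :=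
    PDvd.sum fun k hk => by
      have := Finset.mem_Icc.mp hk
      exact pdvd_inv_pow_sub_pow (by lia) (by lia) (by lia)
  rw [Finset.sum_sub_distrib] at h'
  simpa [invPowSum] using h'.add h

theorem PDvd.half_mul (h2 : 2 < p) {x : ℚ} {e : ℕ} (hx : PDvd p e x) : PDvd p e (x / 2) := by
  have := (PDvd.inv_nat_of_lt (p := p) (a := 2) (by lia) h2).mul_left hx
  convert this using 1
  push_cast
  ring

theorem PDvd.inv_one_sub_pow_sub (h2 : 2 < p) {y : ℚ} (hy : PDvd p 1 y) (a : ℕ) :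
    PDvd p 3 ((1 - y)⁻¹ ^ a - (1 + a * y + a * (a + 1) / 2 * y ^ 2)) := by
  have h0 := hy.one_sub_ne_zero
  induction a with
  | zero => simpa using PDvd.zero
  | succ a ih =>
    have hc : PDvd p 0 (((a : ℚ) + 1) * (a + 2) / 2) := by
      have := (PDvd.nat (p := p) ((a + 1) * (a + 2))).half_mul h2
      push_cast at this
      exact this
    -- If R_a is the remainder, then (1 - y) R_{a+1} = R_a + (a+1)(a+2)/2 · y³.
    have h := hy.inv_one_sub.mul_left (ih.add (hc.mul_left (hy.pow 3)))
    convert h using 1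
    rw [pow_succ]
    push_cast
    field_simp
    ring

theorem PDvd.one_sub_pow_sub (h2 : 2 < p) {y : ℚ} (hy : PDvd p 1 y) (m : ℕ) :
    PDvd p 3 ((1 - y) ^ m - (1 - m * y + m * (m - 1) / 2 * y ^ 2)) := by
  induction m with
  | zero => simpa using PDvd.zero
  | succ m ih =>
    have hc : PDvd p 0 ((m : ℚ) * (m - 1) / 2) := by
      have := (PDvd.int (p := p) ((m : ℤ) * (m - 1))).half_mul h2
      push_cast at this
      exact this
    have h := (((PDvd.one.sub (hy.mono (by lia))).mul_left ih)).sub (hc.mul_left (hy.pow 3))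
    convert h using 1
    rw [pow_succ]
    push_cast
    ring

theorem p_mul_inv_pdvd {k : ℕ} (h0 : 0 < k) (hk : k < p) : PDvd p 1 (p * (k : ℚ)⁻¹) :=
  PDvd.self.mul_right (PDvd.inv_nat_of_lt h0 hk)

/-- Pair k with p - k and expand (p-k)^{-a} = -k^{-a} (1 - p/k)^{-a} to second order. The p² term
drops out because H_{a+2} is divisible by p. -/
theorem pdvd_two_mul_invPowSum_add {a : ℕ} (ha : Odd a) (hap : a + 4 ≤ p) :
    PDvd p 3 (2 * invPowSum a (p - 1) + a * p * invPowSum (a + 1) (p - 1)) := by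
  have key : PDvd p 3 (∑ k ∈ Finset.Icc 1 (p - 1), ((k : ℚ)⁻¹ ^ a + ((p - k : ℕ) : ℚ)⁻¹ ^ a +
      a * p * (k : ℚ)⁻¹ ^ (a + 1) + a * (a + 1) / 2 * p ^ 2 * (k : ℚ)⁻¹ ^ (a + 2))) := by
    refine PDvd.sum fun k hk => ?_
    have hk := Finset.mem_Icc.mp hk
    have h := ((PDvd.inv_nat_of_lt (p := p) (a := k) (by lia) (by lia)).pow a).mul
      (PDvd.inv_one_sub_pow_sub (by lia) (p_mul_inv_pdvd (k := k) (by lia) (by lia)) a).neg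
    convert h.mono (show 3 ≤ _ by lia) using 1
    rw [inv_cast_sub (by lia) (by lia), ha.neg_pow, mul_pow]
    ring
  rw [Finset.sum_add_distrib, Finset.sum_add_distrib, Finset.sum_add_distrib,
    sum_Icc_reflect (fun k => (k : ℚ)⁻¹ ^ a), ← Finset.mul_sum, ← Finset.mul_sum] at key
  have hc : PDvd p 0 ((a : ℚ) * (a + 1) / 2) := by
    have := (PDvd.nat (p := p) (a * (a + 1))).half_mul (by lia)
    push_cast at this
    exact this
  have h := (hc.mul ((PDvd.self (p := p)).pow 2)).mul
    (pdvd_invPowSum (p := p) (s := a + 2) (by lia) (by lia))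
  convert key.sub (h.mono (show 3 ≤ _ by lia)) using 1
  simp only [invPowSum]
  ring

theorem pdvd_two_invPowSum_of_odd {a : ℕ} (ha : Odd a) (hap : a + 4 ≤ p) :
    PDvd p 2 (invPowSum a (p - 1)) := by
  have h1 := pdvd_two_mul_invPowSum_add ha hap
  have h2 := ((PDvd.nat (p := p) a).mul PDvd.self).mul
    (pdvd_invPowSum (p := p) (s := a + 1) (by lia) (by lia))
  refine PDvd.of_nat_mul (a := 2) (by lia) (by lia) ?_
  convert (h1.mono (show 2 ≤ 3 by lia)).sub (h2.mono (show 2 ≤ _ by lia)) using 1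
  push_cast
  ring

theorem pdvd_invHsymm {s : ℕ} (hs : s + 2 ≤ p) : PDvd p 0 (invHsymm s (p - 1)) := by
  induction s using Nat.strong_induction_on with
  | _ s ih =>
    cases s with
    | zero => rw [invHsymm_zero]; exact PDvd.one
    | succ s =>
      refine PDvd.of_nat_mul (a := s + 1) (by lia) (by lia) ?_
      push_cast
      rw [succ_mul_invHsymm]
      refine PDvd.sum fun i hi => ?_
      have hi := Finset.mem_range.mp hi
      exact ((pdvd_invPowSum (by lia) (by lia)).mono (by lia)).mul (ih _ (by lia) (by lia))

theorem pdvd_one_invHsymm {s : ℕ} (h1 : 1 ≤ s) (hs : s + 2 ≤ p) :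
    PDvd p 1 (invHsymm s (p - 1)) := by
  obtain ⟨s, rfl⟩ := Nat.exists_eq_add_of_le' h1
  refine PDvd.of_nat_mul (a := s + 1) (by lia) (by lia) ?_
  push_cast
  rw [succ_mul_invHsymm]
  refine PDvd.sum fun i hi => ?_
  have hi := Finset.mem_range.mp hi
  exact (pdvd_invPowSum (by lia) (by lia)).mul_right (pdvd_invHsymm (by lia))

/-- In each product H_i h_j of Newton's identity i + j is odd: either H_i gives p², or j is odd,
hence nonzero, and each factor gives p. -/
theorem pdvd_two_invHsymm_of_odd {s : ℕ} (h : Odd s) (hs : s + 4 ≤ p) :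
    PDvd p 2 (invHsymm s (p - 1)) := by
  obtain ⟨s, rfl⟩ := Nat.exists_eq_add_of_le' h.pos
  refine PDvd.of_nat_mul (a := s + 1) (by lia) (by lia) ?_
  push_cast
  rw [succ_mul_invHsymm]
  refine PDvd.sum fun i hi => ?_
  have hi := Finset.mem_range.mp hi
  rcases Nat.even_or_odd (i + 1) with hi' | hi'
  · exact (pdvd_invPowSum (by lia) (by lia)).mul (pdvd_one_invHsymm (by grind) (by lia))
  · exact (pdvd_two_invPowSum_of_odd hi' (by lia)).mul_right (pdvd_invHsymm (by lia))

theorem pdvd_mul_invHsymm_sub {s : ℕ} (h1 : 1 ≤ s) (hs : s + 2 ≤ p) :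
    PDvd p 2 (s * invHsymm s (p - 1) - invPowSum s (p - 1)) := by
  obtain ⟨s, rfl⟩ := Nat.exists_eq_add_of_le' h1
  push_cast
  rw [succ_mul_invHsymm, Finset.sum_range_succ, Nat.sub_self, invHsymm_zero, mul_one,
    add_sub_cancel_right]
  refine PDvd.sum fun i hi => ?_
  have hi := Finset.mem_range.mp hi
  exact (pdvd_invPowSum (by lia) (by lia)).mul (pdvd_one_invHsymm (by lia) (by lia))

/-- Apart from H_s itself, each product in Newton's identity has one index odd and one even, which
contribute p² and p. -/
theorem pdvd_mul_invHsymm_sub_of_odd {s : ℕ} (h : Odd s) (hs : s + 4 ≤ p) :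
    PDvd p 3 (s * invHsymm s (p - 1) - invPowSum s (p - 1)) := by
  obtain ⟨s, rfl⟩ := Nat.exists_eq_add_of_le' h.pos
  push_cast
  rw [succ_mul_invHsymm, Finset.sum_range_succ, Nat.sub_self, invHsymm_zero, mul_one,
    add_sub_cancel_right]
  refine PDvd.sum fun i hi => ?_
  have hi := Finset.mem_range.mp hi
  rcases Nat.even_or_odd (i + 1) with hi' | hi'
  · exact (pdvd_invPowSum (by lia) (by lia)).mul (pdvd_two_invHsymm_of_odd (by grind) (by lia))
  · exact (pdvd_two_invPowSum_of_odd hi' (by lia)).mul (pdvd_one_invHsymm (by lia) (by lia))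

end PowerSums

/-! ### Double sums modulo p and Bernoulli numbers -/

section Bernoulli

variable {p : ℕ} [hp : Fact p.Prime]

theorem pdvd_bernoulli' {n : ℕ} (hn : n + 2 ≤ p) : PDvd p 0 (bernoulli' n) := by
  induction n using Nat.strong_induction_on with
  | _ n ih =>
    rw [bernoulli'_def]
    refine PDvd.one.sub (PDvd.sum fun k hk => ?_)
    have hk := Finset.mem_range.mp hk
    refine PDvd.mul_left ?_ (ih k hk (by lia))
    have h := (PDvd.nat (p := p) (n.choose k)).mul
      (PDvd.inv_nat_of_lt (p := p) (a := n - k + 1) (by lia) (by lia))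
    rw [Nat.cast_add, Nat.cast_sub hk.le, Nat.cast_one] at h
    exact h

theorem pdvd_bernoulli {n : ℕ} (hn : n + 2 ≤ p) : PDvd p 0 (bernoulli n) := by
  rw [bernoulli]
  exact PDvd.mul (by exact_mod_cast PDvd.int ((-1) ^ n)) (pdvd_bernoulli' hn)

theorem pdvd_invPowSum_of_lt {s N : ℕ} (hN : N < p) : PDvd p 0 (invPowSum s N) :=
  PDvd.sum fun k hk => by
    have := Finset.mem_Icc.mp hk
    exact ((PDvd.inv_nat_of_lt (p := p) (a := k) (by lia) (by lia)).pow s).mono (by lia)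

theorem pdvd_sum_invPowSum_mul {d s : ℕ} :
    PDvd p 0 (∑ k ∈ Finset.Icc 1 (p - 1), invPowSum d k * (k : ℚ)⁻¹ ^ s) :=
  PDvd.sum fun k hk => by
    have := Finset.mem_Icc.mp hk
    exact (pdvd_invPowSum_of_lt (by lia)).mul_right
      (((PDvd.inv_nat_of_lt (p := p) (a := k) (by lia) (by lia)).pow s).mono (by lia))

/-- Fermat turns negative exponents into nonnegative ones. Faulhaber sums over j < k, so the term j
= k is split off. -/
theorem pdvd_invPowSum_mul_sub {d s k : ℕ} (hd : d + 2 ≤ p) (hs : s + 1 ≤ p)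
    (h0 : 0 < k) (hk : k < p) :
    PDvd p 1 (invPowSum d k * (k : ℚ)⁻¹ ^ s -
      (∑ j ∈ Finset.range k, (j : ℚ) ^ (p - 1 - d)) * (k : ℚ) ^ (p - 1 - s) -
      (k : ℚ)⁻¹ ^ (d + s)) := by
  obtain ⟨k, rfl⟩ := Nat.exists_eq_add_of_le' h0
  have hR : ∑ j ∈ Finset.range (k + 1), (j : ℚ) ^ (p - 1 - d) =
      ∑ j ∈ Finset.Icc 1 k, (j : ℚ) ^ (p - 1 - d) := by
    rw [Finset.range_eq_Ico, Finset.sum_eq_sum_Ico_succ_bot (by lia), Nat.cast_zero,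
      zero_pow (by lia), zero_add]
    rfl
  have h1 : PDvd p 1 (invPowSum d k - ∑ j ∈ Finset.Icc 1 k, (j : ℚ) ^ (p - 1 - d)) := by
    rw [invPowSum, ← Finset.sum_sub_distrib]
    refine PDvd.sum fun j hj => ?_
    have := Finset.mem_Icc.mp hj
    exact pdvd_inv_pow_sub_pow (by lia) (by lia) (by lia)
  have h2 : PDvd p 0 (∑ j ∈ Finset.Icc 1 k, (j : ℚ) ^ (p - 1 - d)) :=
    PDvd.sum fun j _ => by exact_mod_cast PDvd.nat (p := p) (j ^ (p - 1 - d))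
  have h3 : PDvd p 0 (((k + 1 : ℕ) : ℚ)⁻¹ ^ s) :=
    ((PDvd.inv_nat_of_lt h0 hk).pow s).mono (by lia)
  have h4 := pdvd_inv_pow_sub_pow (p := p) (d := s) h0 hk (by lia)
  convert (h1.mul_right h3).add (h2.mul_left h4) using 1
  rw [hR, invPowSum_succ]
  ring

/-- Faulhaber's formula modulo `p`. -/
theorem pdvd_mul_sum_range_pow {a b i₀ : ℕ} (ha : a + 2 ≤ p) (hb : b < p) (hi₀ : i₀ ≤ a)
    (hab : a + 1 + b = p - 1 + i₀) :
    PDvd p 1 ((a + 1) * ∑ k ∈ Finset.Icc 1 (p - 1),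
        (∑ j ∈ Finset.range k, (j : ℚ) ^ a) * (k : ℚ) ^ b +
      (a + 1).choose i₀ * bernoulli i₀) := by
  have hF : ∀ k ∈ Finset.Icc 1 (p - 1), (a + 1) *
      ((∑ j ∈ Finset.range k, (j : ℚ) ^ a) * (k : ℚ) ^ b) =
      ∑ i ∈ Finset.range (a + 1), bernoulli i * (a + 1).choose i * (k : ℚ) ^ (a + 1 - i + b) := by
    intro k _
    rw [sum_range_pow, Finset.sum_mul, Finset.mul_sum]
    refine Finset.sum_congr rfl fun i _ => ?_
    have : (a : ℚ) + 1 ≠ 0 := by positivity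
    rw [pow_add]
    field_simp
  rw [Finset.mul_sum, Finset.sum_congr rfl hF, Finset.sum_comm]
  have h : PDvd p 1 (∑ i ∈ Finset.range (a + 1), bernoulli i * (a + 1).choose i *
      (∑ k ∈ Finset.Icc 1 (p - 1), (k : ℚ) ^ (a + 1 - i + b) +
        if p - 1 ∣ a + 1 - i + b then 1 else 0)) := by
    refine PDvd.sum fun i hi => ?_
    have hi := Finset.mem_range.mp hi
    exact ((pdvd_bernoulli (by lia)).mul (PDvd.nat _)).mul_left (pdvd_sum_pow_add_ite _)
  simp only [mul_add, Finset.sum_add_distrib, Finset.mul_sum] at h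
  convert h using 2
  rw [Finset.sum_eq_single_of_mem i₀ (Finset.mem_range.mpr (by lia))]
  · rw [if_pos ⟨1, by lia⟩]
    ring
  -- The exponent is positive and below 2(p-1), so the only possible multiple of p-1 is p-1 itself,
  -- which forces i = i₀.
  · intro i hi hne
    have hi := Finset.mem_range.mp hi
    rw [if_neg, mul_zero]
    rintro ⟨c, hc⟩
    have h1 : c ≠ 0 := by rintro rfl; lia
    have h2 : c ≠ 1 := by rintro rfl; lia
    have h3 : (p - 1) * 2 ≤ (p - 1) * c := Nat.mul_le_mul_left _ (by lia)
    lia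

theorem pdvd_mul_sum_invPowSum_mul {d s : ℕ} (hd : 1 ≤ d) (hs : 1 ≤ s) (h : d + s + 2 ≤ p) :
    PDvd p 1 (((p - d : ℕ) : ℚ) *
      ∑ k ∈ Finset.Icc 1 (p - 1), invPowSum d k * (k : ℚ)⁻¹ ^ s +
      (p - d).choose s * bernoulli (p - d - s)) := by
  have h1 : PDvd p 1 (∑ k ∈ Finset.Icc 1 (p - 1), (invPowSum d k * (k : ℚ)⁻¹ ^ s -
      (∑ j ∈ Finset.range k, (j : ℚ) ^ (p - 1 - d)) * (k : ℚ) ^ (p - 1 - s) -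
      (k : ℚ)⁻¹ ^ (d + s))) := PDvd.sum fun k hk => by
    have := Finset.mem_Icc.mp hk
    exact pdvd_invPowSum_mul_sub (by lia) (by lia) (by lia) (by lia)
  rw [Finset.sum_sub_distrib, Finset.sum_sub_distrib] at h1
  have h2 := pdvd_mul_sum_range_pow (p := p) (a := p - 1 - d) (b := p - 1 - s) (i₀ := p - d - s)
    (by lia) (by lia) (by lia) (by lia)
  have h3 := pdvd_invPowSum (p := p) (s := d + s) (by lia) (by lia)
  have h4 : p - 1 - d + 1 = p - d := by lia
  have h5 : ((p - 1 - d : ℕ) : ℚ) + 1 = ((p - d : ℕ) : ℚ) := by exact_mod_cast h4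
  rw [h4, h5, Nat.choose_symm (by lia)] at h2
  convert ((PDvd.nat (p := p) (p - d)).mul_left (h1.add h3)).add h2 using 1
  simp only [invPowSum]
  ring

end Bernoulli

/-! ### Reduction of the binomial powers and evaluation of the resulting sums -/

section BinomialPowers

theorem neg_one_pow_mul_choose_sub_one (x : ℚ) (k : ℕ) :
    (-1) ^ k * Ring.choose (x - 1) k = ∏ j ∈ Finset.Icc 1 k, (1 - x * (j : ℚ)⁻¹) := by
  induction k with
  | zero => simp
  | succ k ih =>
    rw [Finset.prod_Icc_succ_top (by lia), ← ih]
    have h := Ring.choose_smul_choose (x - 1) (Nat.le_succ k)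
    rw [Nat.succ_eq_add_one, Nat.choose_succ_self_right, Nat.add_sub_cancel_left,
      Ring.choose_one_right, nsmul_eq_mul] at h
    have h0 : ((k + 1 : ℕ) : ℚ) ≠ 0 := by positivity
    rw [pow_succ]
    field_simp
    push_cast at h ⊢
    linear_combination -h

theorem neg_one_pow_mul_choose_pred {p : ℕ} (hp : 0 < p) (k : ℕ) :
    (-1) ^ k * ((p - 1).choose k : ℚ) = ∏ j ∈ Finset.Icc 1 k, (1 - p * (j : ℚ)⁻¹) := by
  rw [← neg_one_pow_mul_choose_sub_one, ← Ring.choose_natCast, Nat.cast_pred hp]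

variable {p : ℕ} [hp : Fact p.Prime]

theorem pdvd_prod_sub {k : ℕ} (hk : k < p) :
    PDvd p 2 (∏ j ∈ Finset.Icc 1 k, (1 - p * (j : ℚ)⁻¹) - (1 - p * invPowSum 1 k)) := by
  induction k with
  | zero => simpa [invPowSum] using PDvd.zero
  | succ k ih =>
    have hx := p_mul_inv_pdvd (p := p) (k := k + 1) (by lia) hk
    have h1 := (ih (by lia)).mul_right (PDvd.one.sub (hx.mono (by lia)))
    have h2 := (PDvd.self.mul_right (pdvd_invPowSum_of_lt (s := 1) (by lia : k < p))).mul hx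
    rw [Finset.prod_Icc_succ_top (by lia), invPowSum_succ]
    convert h1.add h2 using 1
    ring

theorem pdvd_one_prod_sub {k : ℕ} (hk : k < p) :
    PDvd p 1 (∏ j ∈ Finset.Icc 1 k, (1 - p * (j : ℚ)⁻¹) - 1) := by
  convert ((pdvd_prod_sub hk).mono one_le_two).sub
    (PDvd.self.mul_right (pdvd_invPowSum_of_lt (s := 1) hk)) using 1
  ring

theorem pdvd_sub_one_div_two_mul (h2 : 2 < p) {m : ℕ} (hm : ¬ p ∣ m) :
    PDvd p 0 (((m : ℚ) - 1) / (2 * m)) := by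
  have h := ((PDvd.int (p := p) ((m : ℤ) - 1)).half_mul h2).mul (PDvd.inv_nat hm)
  convert h using 1
  push_cast
  rw [div_mul_eq_div_div, div_eq_mul_inv]

/-- Each factor satisfies (1 - p/(mj))^m ≡ 1 - p/j + (m-1)/(2m) p²/j². The p² corrections add up,
since they multiply quantities that are 1 modulo p. -/
theorem pdvd_prod_pow_sub (h2 : 2 < p) {m k : ℕ} (hm : ¬ p ∣ m) (hk : k < p) :
    PDvd p 3 ((∏ j ∈ Finset.Icc 1 k, (1 - (p / m : ℚ) * (j : ℚ)⁻¹)) ^ m -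
      (∏ j ∈ Finset.Icc 1 k, (1 - p * (j : ℚ)⁻¹) +
        (m - 1) / (2 * m) * p ^ 2 * invPowSum 2 k)) := by
  have hm0 : (m : ℚ) ≠ 0 := by
    rintro h
    exact hm (by rw [Nat.cast_eq_zero.mp h]; exact dvd_zero p)
  have hc := pdvd_sub_one_div_two_mul h2 hm
  generalize hcd : ((m : ℚ) - 1) / (2 * m) = c at hc
  induction k with
  | zero => simpa [invPowSum] using PDvd.zero
  | succ k ih =>
    have hy0 := PDvd.inv_nat_of_lt (p := p) (a := k + 1) (by lia) hk
    have hx := PDvd.self.mul_right hy0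
    have hy : PDvd p 1 ((p / m : ℚ) * ((k + 1 : ℕ) : ℚ)⁻¹) := by
      rw [div_eq_mul_inv]
      exact (PDvd.self.mul_right (PDvd.inv_nat hm)).mul_right hy0
    have h1 := hy.one_sub_pow_sub h2 m
    have hQ := pdvd_one_prod_sub (p := p) (k := k) (by lia)
    have hH := pdvd_invPowSum_of_lt (p := p) (s := 2) (N := k) (by lia)
    have ih := ih (by lia)
    rw [Finset.prod_Icc_succ_top (by lia), Finset.prod_Icc_succ_top (by lia), invPowSum_succ,
      mul_pow]
    generalize ((k + 1 : ℕ) : ℚ)⁻¹ = z at *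
    generalize ∏ j ∈ Finset.Icc 1 k, (1 - (p : ℚ) * (j : ℚ)⁻¹) = Q at *
    generalize (∏ j ∈ Finset.Icc 1 k, (1 - (p / m : ℚ) * (j : ℚ)⁻¹)) ^ m = P at *
    have hz : 1 - (m : ℚ) * (p / m * z) + m * (m - 1) / 2 * (p / m * z) ^ 2 =
        1 - p * z + c * (p * z) ^ 2 := by
      rw [← hcd]
      field_simp
    rw [hz] at h1
    have hw : PDvd p 0 ((1 - p / m * z) ^ m) :=
      ((PDvd.one.sub (hy.mono (by lia))).pow m).mono (by lia)
    have hQ0 : PDvd p 0 (Q + c * p ^ 2 * invPowSum 2 k) := by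
      have := ((hQ.mono (by lia : 0 ≤ 1)).add PDvd.one).add
        (((hc.mul ((PDvd.self (p := p)).pow 2)).mul hH).mono (by lia))
      simpa using this
    have e1 := ((ih.mul_right hw).add (hQ0.mul_left h1))
    have e2 := (hc.mul (hx.pow 2)).mul hQ
    have e3 := ((hc.mul ((PDvd.self (p := p)).pow 2)).mul hH).mul
      (hx.sub ((hc.mul (hx.pow 2)).mono (by lia)))
    convert (e1.add (e2.mono (by lia))).sub (e3.mono (show 3 ≤ _ by lia)) using 1
    ring

theorem binomPowSum_eq (p m s : ℕ) :
    binomPowSum p m s = ∑ k ∈ Finset.Icc 1 (p - 1),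
      (∏ j ∈ Finset.Icc 1 k, (1 - (p / m : ℚ) * (j : ℚ)⁻¹)) ^ m * (k : ℚ)⁻¹ ^ s := by
  refine Finset.sum_congr rfl fun k _ => ?_
  rw [← neg_one_pow_mul_choose_sub_one, mul_pow, pow_mul, inv_pow]
  ring

theorem sum_prod_mul_inv_pow (s : ℕ) {p : ℕ} (hp : 1 < p) :
    ∑ k ∈ Finset.Icc 1 (p - 1),
      (∏ j ∈ Finset.Icc 1 k, (1 - (p : ℚ) * (j : ℚ)⁻¹)) * (k : ℚ)⁻¹ ^ s =
    -invHsymm s (p - 1) := by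
  obtain ⟨q, rfl⟩ := Nat.exists_eq_add_of_le' hp
  rw [show q + 1 + 1 - 1 = q + 1 by lia, ← sum_neg_one_pow_choose_mul_inv_pow]
  refine Finset.sum_congr rfl fun k _ => ?_
  rw [← neg_one_pow_mul_choose_pred (by lia)]
  rfl

theorem pdvd_binomPowSum_add (h2 : 2 < p) {m : ℕ} (hm : ¬ p ∣ m) (s : ℕ) :
    PDvd p 3 (binomPowSum p m s + invHsymm s (p - 1) - (m - 1) / (2 * m) * p ^ 2 *
      ∑ k ∈ Finset.Icc 1 (p - 1), invPowSum 2 k * (k : ℚ)⁻¹ ^ s) := by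
  have h : PDvd p 3 (∑ k ∈ Finset.Icc 1 (p - 1),
      ((∏ j ∈ Finset.Icc 1 k, (1 - (p / m : ℚ) * (j : ℚ)⁻¹)) ^ m -
      (∏ j ∈ Finset.Icc 1 k, (1 - p * (j : ℚ)⁻¹) +
        (m - 1) / (2 * m) * p ^ 2 * invPowSum 2 k)) * (k : ℚ)⁻¹ ^ s) :=
    PDvd.sum fun k hk => by
      have := Finset.mem_Icc.mp hk
      exact (pdvd_prod_pow_sub h2 hm (by lia)).mul_right
        (((PDvd.inv_nat_of_lt (p := p) (a := k) (by lia) (by lia)).pow s).mono (by lia))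
  simp only [sub_mul, add_mul, Finset.sum_sub_distrib, Finset.sum_add_distrib] at h
  rw [sum_prod_mul_inv_pow s hp.out.one_lt, ← binomPowSum_eq] at h
  simp only [mul_assoc, ← Finset.mul_sum] at h ⊢
  convert h using 1
  ring

theorem pdvd_choose_pred_sub {k : ℕ} (hk : k < p) :
    PDvd p 1 (((p - 1).choose k : ℚ) - (-1) ^ k) := by
  have h := pdvd_one_prod_sub hk
  rw [← neg_one_pow_mul_choose_pred hp.out.pos] at h
  have h' := (PDvd.int (p := p) ((-1) ^ k)).mul_left h
  convert h' using 1
  push_cast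
  rw [mul_sub, ← mul_assoc, ← mul_pow]
  simp

theorem pdvd_sum_harmonic_sub {s : ℕ} (hs : Even s) (h1 : 1 ≤ s) (h : s + 3 ≤ p) :
    PDvd p 1 (∑ k ∈ Finset.Icc 1 (p - 1), invPowSum 1 k * (k : ℚ)⁻¹ ^ s -
      bernoulli (p - 1 - s)) := by
  have hF := pdvd_mul_sum_invPowSum_mul (p := p) (d := 1) (s := s) le_rfl h1 (by lia)
  have hC := pdvd_choose_pred_sub (p := p) (k := s) (by lia)
  rw [hs.neg_one_pow] at hC
  have hB := pdvd_bernoulli (p := p) (n := p - 1 - s) (by lia)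
  have hS := pdvd_sum_invPowSum_mul (p := p) (d := 1) (s := s)
  rw [Nat.cast_pred hp.out.pos] at hF
  convert ((PDvd.self.mul_right hS).sub hF).add (hC.mul_right hB) using 1
  ring

theorem pdvd_two_mul_sum_add {s : ℕ} (hs : Odd s) (h : s + 4 ≤ p) :
    PDvd p 1 (2 * ∑ k ∈ Finset.Icc 1 (p - 1), invPowSum 2 k * (k : ℚ)⁻¹ ^ s +
      (s + 1) * bernoulli (p - 2 - s)) := by
  have hF := pdvd_mul_sum_invPowSum_mul (p := p) (d := 2) (s := s) (by lia) hs.pos (by lia)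
  have hC := pdvd_choose_pred_sub (p := p) (k := s) (by lia)
  rw [hs.neg_one_pow] at hC
  have hB := pdvd_bernoulli (p := p) (n := p - 2 - s) (by lia)
  have hS := pdvd_sum_invPowSum_mul (p := p) (d := 2) (s := s)
  have hch : ((p - 2).choose s : ℚ) * (p - 1) = (p - 1).choose s * (p - 1 - s) := by
    have := Nat.choose_mul_succ_eq (p - 2) s
    rw [show p - 2 + 1 = p - 1 by lia] at this
    have := congrArg (Nat.cast : ℕ → ℚ) this
    rw [Nat.cast_mul, Nat.cast_mul, Nat.cast_sub (by lia : s ≤ p - 1),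
      Nat.cast_pred hp.out.pos] at this
    exact this
  -- Modulo p, `hch` reads -C(p-2, s) ≡ (-1)^s (-1-s), and s is odd.
  have hCs : PDvd p 1 (((p - 2).choose s : ℚ) + (s + 1)) := by
    have h1 := PDvd.self.mul_right (PDvd.nat (p := p) ((p - 2).choose s))
    have h2 := hC.mul_right (PDvd.int (p := p) ((p : ℤ) - 1 - s))
    convert (h1.sub h2).add (PDvd.self (p := p)) using 1
    push_cast
    linear_combination -hch
  rw [Nat.cast_sub (by lia : 2 ≤ p)] at hF
  convert ((PDvd.self.mul_right hS).sub hF).add (hCs.mul_right hB) using 1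
  push_cast
  ring

/-- Two evaluations of h_s modulo p² are added: s h_s ≡ H_s from Newton, and -h_s ≡ H_s - p Σ
H_1(k)/k^s from expanding the products in the m = 1 sum. -/
theorem pdvd_succ_mul_invHsymm_sub {s : ℕ} (hs : Even s) (h1 : 1 ≤ s) (h : s + 3 ≤ p) :
    PDvd p 2 ((s + 1) * invHsymm s (p - 1) - p * bernoulli (p - 1 - s)) := by
  have hsum : PDvd p 2 (∑ k ∈ Finset.Icc 1 (p - 1),
      (∏ j ∈ Finset.Icc 1 k, (1 - (p : ℚ) * (j : ℚ)⁻¹) - (1 - p * invPowSum 1 k)) *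
        (k : ℚ)⁻¹ ^ s) :=
    PDvd.sum fun k hk => by
      have := Finset.mem_Icc.mp hk
      exact (pdvd_prod_sub (by lia)).mul_right
        (((PDvd.inv_nat_of_lt (p := p) (a := k) (by lia) (by lia)).pow s).mono (by lia))
  simp only [sub_mul, Finset.sum_sub_distrib, one_mul, mul_assoc, ← Finset.mul_sum] at hsum
  rw [sum_prod_mul_inv_pow s hp.out.one_lt] at hsum
  have hN := pdvd_mul_invHsymm_sub (p := p) h1 (by lia)
  have hB := PDvd.self.mul (pdvd_sum_harmonic_sub (p := p) hs h1 h)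
  convert (hN.sub hsum).add hB using 1
  simp only [invPowSum]
  ring

theorem two_mul_sum_invPowSum_mul (s N : ℕ) :
    2 * ∑ k ∈ Finset.Icc 1 N, invPowSum s k * (k : ℚ)⁻¹ ^ s =
      invPowSum s N ^ 2 + invPowSum (2 * s) N := by
  induction N with
  | zero => simp [invPowSum]
  | succ N ih =>
    rw [Finset.sum_Icc_succ_top (by lia), mul_add, ih, invPowSum_succ, invPowSum_succ]
    ring

/-- Reflection to one order higher gives 2H_1 + pH_2 + p²H_3 + p³H_4 ≡ 0 modulo p^4. The last two
terms vanish since p² divides H_3 (this needs p ≥ 7) and p divides H_4; then divide by p. -/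
theorem pdvd_two_mul_harmonic_div_add (h : 7 ≤ p) :
    PDvd p 3 (2 * (1 / p * invPowSum 1 (p - 1)) + invPowSum 2 (p - 1)) := by
  have hp0 : (p : ℚ) ≠ 0 := by exact_mod_cast hp.out.ne_zero
  have key : PDvd p 4 (∑ k ∈ Finset.Icc 1 (p - 1), ((k : ℚ)⁻¹ ^ 1 + ((p - k : ℕ) : ℚ)⁻¹ ^ 1 +
      p * (k : ℚ)⁻¹ ^ 2 + p ^ 2 * (k : ℚ)⁻¹ ^ 3 + p ^ 3 * (k : ℚ)⁻¹ ^ 4)) := by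
    refine PDvd.sum fun k hk => ?_
    have hk := Finset.mem_Icc.mp hk
    have hk0 := PDvd.inv_nat_of_lt (p := p) (a := k) (by lia) (by lia)
    have hx := p_mul_inv_pdvd (p := p) (k := k) (by lia) (by lia)
    have h := ((hk0.mul (hx.pow 4)).mul hx.inv_one_sub).neg
    have h0 := inv_mul_cancel₀ hx.one_sub_ne_zero
    convert h.mono (show 4 ≤ _ by lia) using 1
    rw [inv_cast_sub (by lia) (by lia)]
    generalize (k : ℚ)⁻¹ = z at *
    linear_combination -z * (1 + p * z + (p * z) ^ 2 + (p * z) ^ 3) * h0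
  simp only [Finset.sum_add_distrib, ← Finset.mul_sum] at key
  rw [sum_Icc_reflect (fun k => (k : ℚ)⁻¹ ^ 1)] at key
  have h3 := ((PDvd.self (p := p)).pow 2).mul
    (pdvd_two_invPowSum_of_odd (p := p) (a := 3) (by decide) (by lia))
  have h4 := ((PDvd.self (p := p)).pow 3).mul
    (pdvd_invPowSum (p := p) (s := 4) (by lia) (by lia))
  refine PDvd.of_p_mul ?_
  convert (key.sub (h3.mono (show 4 ≤ _ by lia))).sub (h4.mono (show 4 ≤ _ by lia)) using 1
  simp only [invPowSum]
  field_simp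
  ring

end BinomialPowers

/-! ### Assembly of the three congruences -/

theorem theorem1p3 (p : ℕ) (hp : p.Prime) (hp3 : 3 < p) (m : ℕ) (hm : 0 < m) (hpm : ¬ p ∣ m) :
    (5 < p →
      RatModEq p 3 (binomPowSum p m 2)
        (1 / (p : ℚ) * ∑ k ∈ Finset.Icc 1 (p - 1), 1 / (k : ℚ))) ∧
    (∀ n : ℕ, 1 ≤ n → n ≤ (p - 3) / 2 →
      RatModEq p 2 (binomPowSum p m (2 * n))
        (-((p : ℚ) / (2 * (n : ℚ) + 1)) * bernoulli (p - 1 - 2 * n))) ∧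
    (∀ n : ℕ, 1 ≤ n → n ≤ (p - 3) / 2 →
      RatModEq p 3 (binomPowSum p m (2 * n - 1))
        ((1 + (1 - (m : ℚ)) / (2 * (m : ℚ)) * (2 * (n : ℚ) + 1)) *
          ((p : ℚ) ^ 2 * (n : ℚ) / (2 * (n : ℚ) + 1)) * bernoulli (p - 1 - 2 * n))) := by
  have : Fact p.Prime := ⟨hp⟩
  have hc := pdvd_sub_one_div_two_mul (by lia : 2 < p) hpm
  have hp2 := (PDvd.self (p := p)).pow 2
  have hA := pdvd_binomPowSum_add (p := p) (by lia) hpm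
  refine ⟨fun hp5 => ?_, fun n h1 hn => ?_, fun n h1 hn => ?_⟩
  · refine PDvd.ratModEq ?_
    have hp7 : 7 ≤ p := by
      have : p ≠ 6 := by rintro rfl; revert hp; decide
      lia
    have hsum : ∑ k ∈ Finset.Icc 1 (p - 1), 1 / (k : ℚ) = invPowSum 1 (p - 1) := by
      simp [invPowSum]
    rw [hsum]
    have hS := (pdvd_invPowSum (p := p) (s := 2) (by lia) (by lia)).pow 2
    have hS4 := pdvd_invPowSum (p := p) (s := 4) (by lia) (by lia)
    have hT := two_mul_sum_invPowSum_mul 2 (p - 1)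
    have hN := succ_mul_invHsymm 1 (p - 1)
    have h11 := succ_mul_invHsymm 0 (p - 1)
    simp only [Finset.sum_range_succ, Finset.sum_range_zero, invHsymm_zero, Nat.cast_zero,
      Nat.cast_one, zero_add, one_mul, mul_one, Nat.sub_zero, Nat.reduceAdd,
      Nat.sub_self] at hN h11
    rw [h11] at hN
    have e1 := (pdvd_two_invPowSum_of_odd (p := p) (a := 1) (by decide) (by lia)).pow 2
    have e2 := (hc.mul hp2).mul ((hS.mono (by lia)).add hS4)
    -- After doubling, 2h_2 = H_1² + H_2 with p^4 dividing H_1², and the double sum is H_2² + H_4,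
    -- divisible by p.
    refine PDvd.of_nat_mul (a := 2) (by lia) (by lia) ?_
    have hA2 := (PDvd.nat (p := p) 2).mul_left (hA 2)
    convert ((hA2.add (e2.mono (show 3 ≤ _ by lia))).sub (e1.mono (show 3 ≤ _ by lia))).sub
      (pdvd_two_mul_harmonic_div_add hp7) using 1
    push_cast
    linear_combination ((m : ℚ) - 1) / (2 * m) * p ^ 2 * hT - hN
  · refine PDvd.ratModEq (PDvd.of_nat_mul (a := 2 * n + 1) (by lia) (by lia) ?_)
    have hT := (hc.mul hp2).mul (pdvd_sum_invPowSum_mul (p := p) (d := 2) (s := 2 * n))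
    have h := pdvd_succ_mul_invHsymm_sub (p := p) (even_two_mul n) (by lia) (by lia)
    have hA' := (PDvd.nat (p := p) (2 * n + 1)).mul_left
      (((hA (2 * n)).mono (show 2 ≤ 3 by lia)).add (hT.mono (show 2 ≤ _ by lia)))
    have hn0 : 2 * (n : ℚ) + 1 ≠ 0 := by positivity
    convert hA'.sub h using 1
    push_cast
    field_simp
    ring
  · obtain ⟨s, hs⟩ : ∃ s, 2 * n - 1 = s := ⟨_, rfl⟩
    have hodd : Odd s := ⟨n - 1, by lia⟩
    have hsn : (s : ℚ) = 2 * n - 1 := by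
      rw [eq_sub_iff_add_eq]
      exact_mod_cast (by lia : s + 1 = 2 * n)
    rw [hs]
    -- Clearing the units 2, s and 2n+1 makes the claim a combination of s h_s ≡ H_s, 2H_s ≡ -s p
    -- H_{2n}, H_{2n} ≡ 2n h_{2n}, (2n+1) h_{2n} ≡ p B_{p-1-2n} and the double sum.
    refine PDvd.ratModEq (PDvd.of_nat_mul (a := 2) (by lia) (by lia)
      (PDvd.of_nat_mul (a := s) (by lia) (by lia)
        (PDvd.of_nat_mul (a := 2 * n + 1) (by lia) (by lia) ?_)))
    have e1 := hA s
    have e2 := pdvd_mul_invHsymm_sub_of_odd (p := p) hodd (by lia)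
    have e3 := pdvd_two_mul_invPowSum_add (p := p) hodd (by lia)
    rw [show s + 1 = 2 * n by lia] at e3
    have e4 := PDvd.self.mul (pdvd_mul_invHsymm_sub (p := p) (s := 2 * n) (by lia) (by lia))
    have e5 := PDvd.self.mul
      (pdvd_succ_mul_invHsymm_sub (p := p) (even_two_mul n) (by lia) (by lia))
    have e6 := (hc.mul hp2).mul (pdvd_two_mul_sum_add (p := p) hodd (by lia))
    rw [show p - 2 - s = p - 1 - 2 * n by lia, hsn] at e6
    have z (a : ℕ) := PDvd.nat (p := p) a
    have hn0 : 2 * (n : ℚ) + 1 ≠ 0 := by positivity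
    have f := (((((z (2 * s * (2 * n + 1))).mul_left e1).sub
      ((z (2 * (2 * n + 1))).mul_left e2)).sub ((z (2 * n + 1)).mul_left e3)).sub
      ((z (s * (2 * n + 1))).mul_left e4)).add ((z (2 * n * s)).mul_left e5) |>.add
      ((z (s * (2 * n + 1))).mul_left e6)
    convert f using 1
    push_cast
    field_simp
    simp only [hsn]
    ring
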